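/- Let $Z$ (the control space) and $X$ (the state space) be real reflexive Banach spaces, let $K : X^* \to X$ be a linear operator, and let $N : X \to X^*$ and $H : Z \to X$ be (possibly nonlinear) operators. Consider the system $$x = KNx + Hu, \qquad u \in Z,\ x \in X. \tag{1}$$ An operator $H : Z \to X$ is called completely continuous if $u_n \rightharpoonup u$ weakly in $Z$ implies $Hu_n \to Hu$ in norm. For an operator $A$ from a Banach space $E$ to its dual $E^*$ put $$\mu(A) = \inf_{x \ne y} \frac{\langle Ax - Ay,\, x - y\rangle}{\|x-y\|^2} \in [-\infty, \infty],$$ and say that $A \in \mathcal M$ if there is a constant $c > 0$ with $\langle Ax - Ay, x - y\rangle \ge c\|x-y\|^2$ for all $x, y \in E$. For $K : X^* \to X$ these notions are understood with $X$ embedded in $X^{**}$ (so for a Hilbert space $X$, identified with $X^*$, the pairing is the inner product throughout). For a Lipschitz operator $N$, let $\|N\|^*$ be its least Lipschitz constant (with $0^{-2} = \infty$). Suppose that $K$, $N$, $H$ satisfy one of the following two sets of assumptions. * [$\mathfrak A$]: $K$ is compact, and there is $d > 0$ with $\langle Kf, f\rangle \ge d\|Kf\|^2$ for all $f \in X^*$;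 $N$ is continuous, maps bounded sets to bounded sets, and is negatively monotone, i.e. $\langle Nx - Ny, x - y\rangle \le 0$ for all $x, y \in X$; $H$ is completely continuous. * [$\mathfrak B$]: $K \in \mathcal M$; $N$ is Lipschitz, $\mu(-N) > 0$ and $(\mu(K) + \mu(-N))\,(\|N\|^*)^{-2} > 0$; $H$ is completely continuous. Then for every $u \in Z$ the system (1) has exactly one solution $x \in X$. Let $T : Z \to X$, $Tu = x$, denote the resulting solution operator, and let $\phi : Z \times T(Z) \to \mathbb R$ be a function such that * $\phi$ is (sequentially) lower semicontinuous with respect to the weak topology of $Z$ and the norm topology of $T(Z)$: if $u_n \rightharpoonup u$ weakly in $Z$ and $x_n \to x$ in norm, with $x_n, x \in T(Z)$, then $\phi(u, x) \le \liminf_n \phi(u_n, x_n)$; * $\phi(u, Tu) \to \infty$ as $\|u\| \to \infty$. Then there is an optimal pair: there are $u^* \in Z$ and $x^* = Tu^*$ with $\phi(u^*, x^*) \le \phi(u, Tu)$ for all $u \in Z$. -/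

import Mathlib

open Filter Topology Set
open scoped NNReal ENNReal

noncomputable section

namespace Hammerstein

/-- A normed space is reflexive if the canonical map into its double dual is onto. -/
def IsReflexive (E : Type*) [NormedAddCommGroup E] [NormedSpace ℝ E] : Prop :=
  Function.Surjective (NormedSpace.inclusionInDoubleDual ℝ E)

/-- Weak convergence of a sequence in a normed space: convergence in the weak topology. -/
def WeaklyConverges {E : Type*} [NormedAddCommGroup E] [NormedSpace ℝ E]
    (u : ℕ → E) (u₀ : E) : Prop :=
  Tendsto (fun n => toWeakSpace ℝ E (u n)) atTop (𝓝 (toWeakSpace ℝ E u₀))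

/-- A (possibly nonlinear) operator is completely continuous if it maps weakly convergent
sequences to norm convergent sequences, with the corresponding limit. -/
def IsCompletelyContinuous {E F : Type*} [NormedAddCommGroup E] [NormedSpace ℝ E]
    [NormedAddCommGroup F] (H : E → F) : Prop :=
  ∀ (u : ℕ → E) (u₀ : E), WeaklyConverges u u₀ → Tendsto (fun n => H (u n)) atTop (𝓝 (H u₀))

/-- A (possibly nonlinear) operator is bounded if it maps bounded sets to bounded sets. -/
def IsBoundedOperator {E F : Type*} [NormedAddCommGroup E] [NormedAddCommGroup F]
    (N : E → F) : Prop :=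
  ∀ s : Set E, Bornology.IsBounded s → Bornology.IsBounded (N '' s)

/-- `⟨N x - N y, x - y⟩ ≤ 0` for all `x`, `y`. -/
def IsNegativelyMonotone {E : Type*} [NormedAddCommGroup E] [NormedSpace ℝ E]
    (N : E → StrongDual ℝ E) : Prop :=
  ∀ x y : E, (N x - N y) (x - y) ≤ 0

/-- The class `M`: `⟨A x - A y, x - y⟩ ≥ c ‖x - y‖ ^ 2` with a positive constant `c`.
On a Hilbert space identified with its dual, the pairing is the inner product. -/
def InClassM {E : Type*} [NormedAddCommGroup E] [NormedSpace ℝ E]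
    (A : E → StrongDual ℝ E) : Prop :=
  ∃ c : ℝ, 0 < c ∧ ∀ x y : E, c * ‖x - y‖ ^ 2 ≤ (A x - A y) (x - y)

/-- `μ(A)`, the infimum of `⟨A x - A y, x - y⟩ / ‖x - y‖ ^ 2` over `x ≠ y`, in `[-∞, ∞]`. -/
def mu {E : Type*} [NormedAddCommGroup E] [NormedSpace ℝ E]
    (A : E → StrongDual ℝ E) : EReal :=
  ⨅ (x : E) (y : E) (_ : x ≠ y), (((A x - A y) (x - y) / ‖x - y‖ ^ 2 : ℝ) : EReal)

/-- `‖N‖*`, the least Lipschitz constant of `N`, in `[0, ∞]`. -/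
def lipNorm {E F : Type*} [NormedAddCommGroup E] [NormedAddCommGroup F]
    (N : E → F) : ℝ≥0∞ :=
  ⨆ (x : E) (y : E) (_ : x ≠ y), edist (N x) (N y) / edist x y

/-- An operator from `X*` to `X`, seen as an operator from `X*` to its dual `X**`, so that
`⟨viaDoubleDual K f, g⟩ = g (K f)`. -/
def viaDoubleDual {X : Type*} [NormedAddCommGroup X] [NormedSpace ℝ X]
    (K : StrongDual ℝ X → X) : StrongDual ℝ X → StrongDual ℝ (StrongDual ℝ X) :=
  fun f => NormedSpace.inclusionInDoubleDual ℝ X (K f)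

variable {Z X : Type*} [NormedAddCommGroup Z] [NormedSpace ℝ Z]
  [NormedAddCommGroup X] [NormedSpace ℝ X]

/-- Assumptions `[𝔄]` on the operators `K` (linear), `N` and `H`. -/
structure AssumptionsA (K : StrongDual ℝ X →ₗ[ℝ] X) (N : X → StrongDual ℝ X) (H : Z → X) :
    Prop where
  compact : IsCompactOperator K
  coercive : ∃ d : ℝ, 0 < d ∧ ∀ f : StrongDual ℝ X, d * ‖K f‖ ^ 2 ≤ f (K f)
  continuous : Continuous N
  bounded : IsBoundedOperator N
  monotone : IsNegativelyMonotone N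
  completelyContinuous : IsCompletelyContinuous H

/-- Assumptions `[𝔅]` on the operators `K` (linear), `N` and `H`. -/
structure AssumptionsB (K : StrongDual ℝ X →ₗ[ℝ] X) (N : X → StrongDual ℝ X) (H : Z → X) :
    Prop where
  classM : InClassM (viaDoubleDual K)
  lipschitz : ∃ C : ℝ≥0, LipschitzWith C N
  mu_pos : 0 < mu (-N)
  mu_add_pos : 0 < (mu (viaDoubleDual K) + mu (-N)) * (((lipNorm N ^ 2)⁻¹ : ℝ≥0∞) : EReal)
  completelyContinuous : IsCompletelyContinuous H

/-- The state `x` solves `x = K N x + H u` for the control `u`. -/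
def Solves (K : StrongDual ℝ X →ₗ[ℝ] X) (N : X → StrongDual ℝ X) (H : Z → X)
    (u : Z) (x : X) : Prop :=
  x = K (N x) + H u

/-- Sequential lower semicontinuity of a real function on `Z × S`, `S ⊆ X`, with respect to the
weak topology of `Z` and the norm topology of `S`. -/
def WeakStrongLSC {S : Set X} (φ : Z × S → ℝ) : Prop :=
  ∀ (u : ℕ → Z) (u₀ : Z) (x : ℕ → S) (x₀ : S),
    WeaklyConverges u u₀ → Tendsto x atTop (𝓝 x₀) →
      ((φ (u₀, x₀) : ℝ) : EReal) ≤ liminf (fun n => ((φ (u n, x n) : ℝ) : EReal)) atTop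

/-- `(u, x)` is an optimal pair: it solves the system and minimizes `φ` among all the pairs
that solve the system. -/
def IsOptimalPair (K : StrongDual ℝ X →ₗ[ℝ] X) (N : X → StrongDual ℝ X) (H : Z → X)
    {S : Set X} (φ : Z × S → ℝ) (u : Z) (x : S) : Prop :=
  Solves K N H u x ∧ ∀ (u' : Z) (x' : S), Solves K N H u' x' → φ (u, x) ≤ φ (u', x')

end Hammerstein

end

/-! Both sets of assumptions reduce to `IsSolvablePair`: `K` is bounded with `d‖Kf‖² ≤ ⟨Kf, f⟩`, and
`N` is continuous, bounded and negatively monotone.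

Existence: seek `f = N(Kf + h)` and put `x = Kf + h`. A minimax argument on a weak-* compact ball of
`X*` (`exists_monotone_related`) gives an `f` monotonically related to `N` on a ball of `X`. Testing
at `y = h` bounds `Kf`, so `Kf + h` is interior to that ball, and Minty's lemma gives the equation.

Uniqueness and norm-continuous dependence on `h` follow from one estimate,
`IsSolvablePair.stability`. Since `H` is completely continuous, so is `T`. Hence `u ↦ φ(u, Tu)` is
weakly sequentially lower semicontinuous and coercive, and the direct method in the reflexive space
`Z` yields a minimizer. -/

namespace Hammerstein

/-- Ky Fan's criterion for the solvability of a system of convex inequalities. -/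
theorem exists_forall_nonpos_of_convex_combinations {E ι : Type*} [TopologicalSpace E] [T2Space E]
    [AddCommGroup E] [Module ℝ E] [IsTopologicalAddGroup E] [ContinuousSMul ℝ E]
    {B : Set E} (hB : IsCompact B) (hBc : Convex ℝ B) (hBne : B.Nonempty)
    {φ : ι → E → ℝ} (hlsc : ∀ i, LowerSemicontinuous (φ i))
    (hconv : ∀ i, ConvexOn ℝ univ (φ i))
    (h : ∀ (s : Finset ι) (w : s → ℝ), w ∈ stdSimplex ℝ s → ∃ f ∈ B, ∑ i, w i * φ i f ≤ 0) :
    ∃ f ∈ B, ∀ i, φ i f ≤ 0 := by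
  classical
  have hfin : ∀ s : Finset ι, (B ∩ ⋂ i ∈ s, {f | φ i f ≤ 0}).Nonempty := by
    intro s
    by_contra hne
    -- The vertices of the simplex recover the individual inequalities. If at every point of `B`
    -- some vertex gives a positive value, Sion's theorem produces a single weight `w` positive on
    -- all of `B`, against `h`.
    have hpos : ∀ f ∈ B, ∃ y ∈ range (fun i : s => (Pi.single i 1 : s → ℝ)),
        0 < ∑ i, y i * φ i f := by
      intro f hf
      by_contra! hle
      refine hne ⟨f, hf, mem_iInter₂.2 fun i hi => ?_⟩
      simpa [Pi.single_apply] using hle _ ⟨⟨i, hi⟩, rfl⟩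
    obtain ⟨w, hw, hwpos⟩ := Sion.exists_lt_iInf_of_lt_iInf_of_finite
      (X := B) (Y := stdSimplex ℝ s) (f := fun f (y : s → ℝ) => ∑ i, y i * φ i f)
      hBne hB
      (fun y hy => by
        refine LowerSemicontinuous.lowerSemicontinuousOn ?_ _
        refine lowerSemicontinuous_sum fun i _ => ?_
        exact (continuous_const.mul continuous_id).comp_lowerSemicontinuous (hlsc i)
          (fun a b hab => mul_le_mul_of_nonneg_left hab (hy.1 i)))
      (fun y hy => by
        refine ConvexOn.quasiconvexOn ⟨hBc, fun a _ b _ p q hp hq hpq => ?_⟩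
        simp only [smul_eq_mul, Finset.mul_sum, ← Finset.sum_add_distrib]
        refine Finset.sum_le_sum fun i _ => ?_
        have := (hconv i).2 (mem_univ a) (mem_univ b) hp hq hpq
        simp only [smul_eq_mul] at this
        nlinarith [mul_le_mul_of_nonneg_left this (hy.1 i)])
      (convex_stdSimplex ℝ s)
      (fun f _ => (by fun_prop : Continuous fun y : s → ℝ =>
        ∑ i, y i * φ i f).upperSemicontinuous.upperSemicontinuousOn _)
      (fun f _ => by
        refine ConcaveOn.quasiconcaveOn ⟨convex_stdSimplex ℝ s, fun a _ b _ p q _ _ _ => ?_⟩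
        refine le_of_eq ?_
        simp only [smul_eq_mul, Finset.mul_sum, ← Finset.sum_add_distrib, Pi.add_apply,
          Pi.smul_apply]
        exact Finset.sum_congr rfl fun i _ => by ring)
      hBc (finite_range _)
      (by rintro _ ⟨i, rfl⟩; exact single_mem_stdSimplex ℝ i) hpos
    obtain ⟨f, hf, hle⟩ := h s w hw
    exact absurd (hwpos f hf) (not_lt.2 hle)
  obtain ⟨f, hf, hf'⟩ := hB.inter_iInter_nonempty (fun i => {f | φ i f ≤ 0})
    (fun i => (hlsc i).isClosed_preimage 0) hfin
  exact ⟨f, hf, fun i => mem_iInter.1 hf' i⟩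

/-! ### The Hammerstein equation: existence, uniqueness, stability -/

section Equation

variable {X : Type*} [NormedAddCommGroup X] [NormedSpace ℝ X]

theorem IsReflexive.continuous_weakDual (hX : IsReflexive X) (G : StrongDual ℝ (StrongDual ℝ X)) :
    Continuous fun f : WeakDual ℝ X => G (WeakDual.toStrongDual f) := by
  obtain ⟨x, rfl⟩ := hX G
  exact WeakDual.eval_continuous x

/-- This expands `0 ≤ ⟨K(f - g), f - g⟩`. The left side is affine in `f`, hence weak-* continuous
when `X` is reflexive; it supplies lower semicontinuity of the quadratic form. -/
theorem quadratic_ge_tangent (K : StrongDual ℝ X →L[ℝ] X) (hK : ∀ f : StrongDual ℝ X, 0 ≤ f (K f))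
    (f g : StrongDual ℝ X) : f (K g) + g (K f) - g (K g) ≤ f (K f) := by
  have := hK (f - g)
  simp only [map_sub, _root_.sub_apply] at this
  linarith

theorem exists_monotone_related (hX : IsReflexive X) (K : StrongDual ℝ X →L[ℝ] X)
    (hK : ∀ f : StrongDual ℝ X, 0 ≤ f (K f)) (N : X → StrongDual ℝ X) (hN : IsNegativelyMonotone N)
    (h : X) {S : Set X} (hS : Bornology.IsBounded (N '' S)) :
    ∃ f : StrongDual ℝ X, ∀ y ∈ S, (f - N y) (K f + h - y) ≤ 0 := by
  obtain ⟨R, hR0, hR⟩ := hS.subset_closedBall_lt 0 0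
  set B : Set (WeakDual ℝ X) := WeakDual.toStrongDual ⁻¹' Metric.closedBall 0 R with hBdef
  obtain ⟨f, -, hf⟩ := exists_forall_nonpos_of_convex_combinations (B := B)
    (φ := fun (y : S) (f : WeakDual ℝ X) =>
      (WeakDual.toStrongDual f - N y) (K (WeakDual.toStrongDual f) + h - y))
    (WeakDual.isCompact_closedBall 0 R)
    ((convex_closedBall (0 : StrongDual ℝ X) R).is_linear_preimage
      WeakDual.toStrongDual.toLinearMap.isLinear)
    ⟨0, by simp [hBdef, hR0.le]⟩
    (fun y f₀ c hc => by
      -- The tangent minorant at `f₀` plus the affine terms: weak-* continuous, below the function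
      -- everywhere, and equal to it at `f₀`.
      have hcont : Continuous fun f : WeakDual ℝ X =>
          f (K (WeakDual.toStrongDual f₀))
            + ((WeakDual.toStrongDual f₀).comp K) (WeakDual.toStrongDual f)
            - WeakDual.toStrongDual f₀ (K (WeakDual.toStrongDual f₀))
            + f (h - y) - ((N y).comp K) (WeakDual.toStrongDual f) - N y (h - y) :=
        ((((WeakDual.eval_continuous _).add (hX.continuous_weakDual _)).sub
          continuous_const).add (WeakDual.eval_continuous _)).sub
          (hX.continuous_weakDual _) |>.sub continuous_const
      have hev := (hcont.tendsto f₀).eventually (lt_mem_nhds (a := c) (by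
        refine lt_of_lt_of_eq hc ?_
        simp only [_root_.sub_apply, map_sub, map_add, WeakDual.toStrongDual_apply,
          ContinuousLinearMap.comp_apply]
        ring))
      filter_upwards [hev] with f hf
      refine lt_of_lt_of_le hf ?_
      have := quadratic_ge_tangent K hK (WeakDual.toStrongDual f) (WeakDual.toStrongDual f₀)
      simp only [_root_.sub_apply, map_sub, map_add, WeakDual.toStrongDual_apply,
        ContinuousLinearMap.comp_apply] at this ⊢
      linarith)
    (fun y => ⟨convex_univ, fun f _ g _ p q hp hq hpq => by
      -- The convexity gap is exactly `p q ⟨K(f - g), f - g⟩`.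
      have hpos := mul_nonneg (mul_nonneg hp hq)
        (hK (WeakDual.toStrongDual f - WeakDual.toStrongDual g))
      obtain rfl : q = 1 - p := by linarith
      simp only [_root_.sub_apply, _root_.add_apply,
        _root_.smul_apply, map_sub, map_add, map_smul, smul_eq_mul] at hpos ⊢
      nlinarith [hpos]⟩)
    (fun s w hw => by
      -- For this `f` one has `∑ wᵢ (f - N yᵢ) = 0`, so the terms in `K f + h` cancel. Symmetrizing
      -- the remaining double sum leaves half of `∑ wᵢ wⱼ ⟨N yᵢ - N yⱼ, yᵢ - yⱼ⟩ ≤ 0`.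
      refine ⟨StrongDual.toWeakDual (∑ i, w i • N i), ?_, ?_⟩
      · exact (convex_closedBall (0 : StrongDual ℝ X) R).sum_mem (fun i _ => hw.1 i) hw.2
          fun i _ => hR ⟨i, i.1.2, rfl⟩
      · set f : StrongDual ℝ X := ∑ i, w i • N i with hfdef
        change ∑ i, w i * ((f - N i) (K f + h - i)) ≤ 0
        have e1 : ∀ x, ∑ i, w i * N i x = f x := fun x => by
          simp [hfdef]
        have e2 : ∑ i, w i * f i = ∑ i, ∑ j, w i * w j * N j i :=
          Finset.sum_congr rfl fun i _ => by
            rw [← e1, Finset.mul_sum]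
            exact Finset.sum_congr rfl fun j _ => by ring
        have e3 : ∑ i, w i * N i i = ∑ i, ∑ j, w i * w j * N i i :=
          Finset.sum_congr rfl fun i _ => by
            rw [← Finset.sum_mul, ← Finset.mul_sum, hw.2, mul_one]
        have e4 : ∑ i, w i * ((f - N i) (K f + h - i))
            = ∑ i, ∑ j, w i * w j * (N i i - N j i) := by
          have : ∑ i, w i * ((f - N i) (K f + h - i)) =
              (∑ i, w i) * f (K f + h) - ∑ i, w i * N i (K f + h) - ∑ i, w i * f i
                + ∑ i, w i * N i i := by
            rw [Finset.sum_mul, ← Finset.sum_sub_distrib, ← Finset.sum_sub_distrib,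
              ← Finset.sum_add_distrib]
            refine Finset.sum_congr rfl fun i _ => ?_
            simp only [_root_.sub_apply, map_sub, map_add]
            ring
          rw [this, e1, hw.2, e2, e3]
          simp only [mul_sub, Finset.sum_sub_distrib]
          ring
        have e5 : ∑ i, ∑ j, w i * w j * (N i i - N j i)
            = ∑ i, ∑ j, w i * w j * (N j j - N i j) := by
          rw [Finset.sum_comm]
          exact Finset.sum_congr rfl fun i _ => Finset.sum_congr rfl fun j _ => by ring
        have e6 : ∑ i, ∑ j, w i * w j * (N i i - N j i)
            + ∑ i, ∑ j, w i * w j * (N j j - N i j) ≤ 0 := by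
          rw [← Finset.sum_add_distrib]
          refine Finset.sum_nonpos fun i _ => ?_
          rw [← Finset.sum_add_distrib]
          refine Finset.sum_nonpos fun j _ => ?_
          have := mul_nonpos_of_nonneg_of_nonpos (mul_nonneg (hw.1 i) (hw.1 j)) (hN i j)
          simp only [_root_.sub_apply, map_sub] at this
          linarith
        linarith)
  exact ⟨WeakDual.toStrongDual f, fun y hy => hf ⟨y, hy⟩⟩

/-- Minty's lemma, localized at an interior point. -/
theorem eq_of_monotone_related {N : X → StrongDual ℝ X} (hN : Continuous N) {f : StrongDual ℝ X}
    {x : X} {S : Set X} (hS : S ∈ 𝓝 x) (h : ∀ y ∈ S, (f - N y) (x - y) ≤ 0) : f = N x := by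
  have key : ∀ v, (f - N x) v ≤ 0 := by
    intro v
    -- Test with `y = x - t v`, divide by `t > 0`, and let `t → 0`.
    have hlim : Tendsto (fun t : ℝ => x - t • v) (𝓝[>] 0) (𝓝 x) := by
      have : Continuous fun t : ℝ => x - t • v := by fun_prop
      simpa using (this.tendsto 0).mono_left nhdsWithin_le_nhds
    have hlim' : Tendsto (fun t : ℝ => (f - N (x - t • v)) v) (𝓝[>] 0) (𝓝 ((f - N x) v)) :=
      ((ContinuousLinearMap.apply ℝ ℝ v).continuous.tendsto _).comp
        (tendsto_const_nhds.sub ((hN.tendsto x).comp hlim))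
    refine le_of_tendsto hlim' ?_
    filter_upwards [hlim hS, self_mem_nhdsWithin] with t ht htpos
    have := h _ ht
    rw [sub_sub_cancel, map_smul, smul_eq_mul] at this
    exact nonpos_of_mul_nonpos_right this htpos
  ext v
  have h1 := key v
  have h2 := key (-v)
  simp only [map_neg, _root_.sub_apply] at h1 h2
  linarith

/-- The properties shared by both sets of assumptions that yield the solvability of the
Hammerstein equation. -/
structure IsSolvablePair (K : StrongDual ℝ X →L[ℝ] X) (N : X → StrongDual ℝ X) (d : ℝ) :
    Prop where
  pos : 0 < d
  coercive : ∀ f : StrongDual ℝ X, d * ‖K f‖ ^ 2 ≤ f (K f)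
  continuous : Continuous N
  bounded : IsBoundedOperator N
  monotone : IsNegativelyMonotone N

variable {K : StrongDual ℝ X →L[ℝ] X} {N : X → StrongDual ℝ X} {d : ℝ}

/-- A priori bound: `d‖Kf‖² ≤ f(Kf) ≤ (N h)(Kf) ≤ ‖N h‖‖Kf‖`. The hypothesis is the monotone
relation for `x = Kf + h` tested at `y = h`. -/
theorem IsSolvablePair.norm_le (hKN : IsSolvablePair K N d) {f : StrongDual ℝ X} {h : X}
    (hf : (f - N h) (K f) ≤ 0) : ‖K f‖ ≤ ‖N h‖ / d := by
  have hd := hKN.pos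
  have h1 := hKN.coercive f
  have h2 := (le_abs_self _).trans ((N h).le_opNorm (K f))
  rw [_root_.sub_apply] at hf
  rw [le_div_iff₀ hd]
  by_contra! hlt
  have h3 : 0 < ‖K f‖ := by
    by_contra! h0
    have := norm_nonneg (N h)
    nlinarith
  nlinarith

theorem IsSolvablePair.exists_solution (hX : IsReflexive X) (hKN : IsSolvablePair K N d) (h : X) :
    ∃ x, x = K (N x) + h := by
  -- Large enough for `h` to be a test point and, by the a priori bound, for `Kf + h` to lie in the
  -- open ball.
  set r : ℝ := ‖h‖ + ‖N h‖ / d + 1 with hr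
  have hq : 0 ≤ ‖N h‖ / d := div_nonneg (norm_nonneg _) hKN.pos.le
  obtain ⟨f, hf⟩ := exists_monotone_related hX K
    (fun f => (mul_nonneg hKN.pos.le (sq_nonneg _)).trans (hKN.coercive f)) N hKN.monotone h
    (hKN.bounded (Metric.ball 0 r) Metric.isBounded_ball)
  have hb := hKN.norm_le (f := f) (h := h) <| by
    simpa using hf h (by rw [mem_ball_zero_iff]; linarith)
  have hmem : K f + h ∈ Metric.ball (0 : X) r := by
    rw [mem_ball_zero_iff]
    linarith [norm_add_le (K f) h]
  have hfN := eq_of_monotone_related hKN.continuous (Metric.isOpen_ball.mem_nhds hmem) hf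
  exact ⟨K f + h, by rw [← hfN]⟩

/-- Since `K(Nx - Ny) = (x - y) - (g - h)`, apply coercivity to `Nx - Ny`; negative monotonicity
discards the pairing with `x - y`. -/
theorem IsSolvablePair.stability (hKN : IsSolvablePair K N d) {x y g h : X}
    (hx : x = K (N x) + g) (hy : y = K (N y) + h) :
    d * ‖(x - y) - (g - h)‖ ^ 2 ≤ ‖N x - N y‖ * ‖g - h‖ := by
  have e : K (N x - N y) = (x - y) - (g - h) := by
    rw [map_sub, eq_sub_of_add_eq hx.symm, eq_sub_of_add_eq hy.symm]
    abel
  have h1 := hKN.coercive (N x - N y)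
  rw [e] at h1
  have h2 := hKN.monotone x y
  have h3 := (neg_le_abs _).trans ((N x - N y).le_opNorm (g - h))
  rw [map_sub (N x - N y) (x - y)] at h1
  linarith

theorem IsSolvablePair.solution_unique (hKN : IsSolvablePair K N d) {x y h : X}
    (hx : x = K (N x) + h) (hy : y = K (N y) + h) : x = y := by
  have h1 := hKN.stability hx hy
  have hd := hKN.pos
  simp only [sub_self, sub_zero, norm_zero, mul_zero] at h1
  have h2 : ‖x - y‖ ^ 2 ≤ 0 := by
    by_contra! hlt
    nlinarith
  exact sub_eq_zero.1 (norm_eq_zero.1 (pow_eq_zero_iff two_ne_zero |>.1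
    (le_antisymm h2 (sq_nonneg _))))

/-- The a priori bound keeps `x n`, hence `N (x n)`, bounded, so the right side of the stability
estimate tends to zero with `h n - h₀`. -/
theorem IsSolvablePair.tendsto_solution (hKN : IsSolvablePair K N d) {x h : ℕ → X} {x₀ h₀ : X}
    (hx : ∀ n, x n = K (N (x n)) + h n) (hx₀ : x₀ = K (N x₀) + h₀)
    (hh : Tendsto h atTop (𝓝 h₀)) : Tendsto x atTop (𝓝 x₀) := by
  have hd := hKN.pos
  obtain ⟨C, hC⟩ := (Metric.isBounded_range_of_tendsto h hh).exists_norm_le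
  obtain ⟨D, hD⟩ := (Metric.isBounded_range_of_tendsto _
    ((hKN.continuous.tendsto h₀).comp hh)).exists_norm_le
  have hxb : ∀ n, ‖x n‖ ≤ D / d + C := by
    intro n
    have h1 : ‖K (N (x n))‖ ≤ ‖N (h n)‖ / d := hKN.norm_le <| by
      have := hKN.monotone (x n) (h n)
      rwa [sub_eq_of_eq_add (hx n)] at this
    have h2 : ‖N (h n)‖ / d ≤ D / d :=
      div_le_div_of_nonneg_right (hD _ ⟨n, rfl⟩) hd.le
    have h3 := norm_add_le (K (N (x n))) (h n)
    rw [← hx n] at h3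
    linarith [hC _ ⟨n, rfl⟩]
  obtain ⟨M, hM⟩ := (hKN.bounded (Metric.closedBall 0 (D / d + C))
    Metric.isBounded_closedBall).exists_norm_le
  have hNb : ∀ n, ‖N (x n) - N x₀‖ ≤ M + ‖N x₀‖ := fun n =>
    (norm_sub_le _ _).trans (by
      gcongr
      exact hM _ ⟨x n, by simpa using hxb n, rfl⟩)
  have hh0 : Tendsto (fun n => h n - h₀) atTop (𝓝 0) := by
    simpa using hh.sub_const h₀
  have hsq : Tendsto (fun n => ‖(x n - x₀) - (h n - h₀)‖ ^ 2) atTop (𝓝 0) := by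
    refine squeeze_zero (fun n => sq_nonneg _)
      (g := fun n => (M + ‖N x₀‖) / d * ‖h n - h₀‖) (fun n => ?_) ?_
    · rw [div_mul_eq_mul_div, le_div_iff₀ hd]
      have := hKN.stability (hx n) hx₀
      have := mul_le_mul_of_nonneg_right (hNb n) (norm_nonneg (h n - h₀))
      linarith
    · simpa using hh0.norm.const_mul ((M + ‖N x₀‖) / d)
  have hz : Tendsto (fun n => (x n - x₀) - (h n - h₀)) atTop (𝓝 0) := by
    rw [tendsto_zero_iff_norm_tendsto_zero]
    simpa [Real.sqrt_sq] using hsq.sqrt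
  simpa using (hz.add hh0).add_const x₀

/-- Closed graph theorem: if `u n → f` and `K (u n) → x`, positivity at `u n - f - t g` passes to
the limit as `t² g(Kg) - t g(x - Kf) ≥ 0` for every `t`, which forces `g(x - Kf) ≤ 0` for all `g`.
-/
theorem continuous_of_monotone [CompleteSpace X] (K : StrongDual ℝ X →ₗ[ℝ] X)
    (hK : ∀ f : StrongDual ℝ X, 0 ≤ f (K f)) : Continuous K := by
  refine K.continuous_of_seq_closed_graph fun u f x hu hKu => ?_
  have key : ∀ g : StrongDual ℝ X, g (x - K f) ≤ 0 := by
    intro g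
    have hlim : ∀ t : ℝ, 0 ≤ (t • g) (K (t • g)) - (t • g) (x - K f) := by
      intro t
      have h1 : Tendsto (fun n => (u n - f - t • g) (K (u n) - K f - K (t • g))) atTop
          (𝓝 ((f - f - t • g) (x - K f - K (t • g)))) :=
        ((isBoundedBilinearMap_apply (𝕜 := ℝ) (E := X) (F := ℝ)).continuous.tendsto _).comp
          (((hu.sub_const f).sub_const _).prodMk_nhds ((hKu.sub_const _).sub_const _))
      have h2 := ge_of_tendsto' h1 fun n => by
        rw [← map_sub, ← map_sub]
        exact hK _
      rw [sub_self, zero_sub, map_sub] at h2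
      simp only [_root_.neg_apply] at h2
      linarith
    by_contra! hpos
    have hq := hK g
    -- With `a = g(x - Kf)` and `b = g(Kg)`, this `t` gives `t b ≤ a / 2 < a`; the `+ 1` covers `b =
    -- 0`.
    have h1 := hlim (g (x - K f) / (2 * (g (K g) + 1)))
    simp only [map_smul, _root_.smul_apply, smul_eq_mul] at h1
    set a := g (x - K f)
    set b := g (K g)
    have hb : 0 < 2 * (b + 1) := by linarith
    have hc : 0 < a / (2 * (b + 1)) := div_pos hpos hb
    have h2 : a / (2 * (b + 1)) * b ≤ a / 2 := by
      rw [div_mul_eq_mul_div, div_le_div_iff₀ hb two_pos]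
      nlinarith
    nlinarith
  refine sub_eq_zero.1 ((SeparatingDual.eq_zero_iff_forall_dual_eq_zero (R := ℝ) _).2 fun g => ?_)
  have h1 := key g
  have h2 := key (-g)
  simp only [_root_.neg_apply] at h2
  linarith

end Equation

end Hammerstein

namespace Hammerstein

/-! ### Weak sequential compactness in reflexive spaces -/

section WeakSequentialCompactness

variable {E : Type*} [NormedAddCommGroup E] [NormedSpace ℝ E]

theorem IsReflexive.isCompact_closure (hE : IsReflexive E) {S : Set E}
    (hS : Bornology.IsBounded S) : IsCompact (closure (toWeakSpace ℝ E '' S)) := by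
  refine NormedSpace.isCompact_closure_of_isBounded ℝ E _ ?_ fun G _ => ?_
  · rwa [preimage_image_eq _ (toWeakSpace ℝ E).injective]
  · obtain ⟨x, hx⟩ := hE (WeakDual.toStrongDual G)
    exact ⟨toWeakSpace ℝ E x, congrArg StrongDual.toWeakDual hx⟩

/-- Take norming functionals of a countable set `e n` whose closure contains `Y`. If all vanish at
`x`, then `‖e n‖ ≤ ‖x - e n‖`, so `‖x‖ ≤ 2‖x - e n‖`, contradicting density unless `x = 0`. -/
theorem exists_seq_dual_separating {Y : Set E} (hY : TopologicalSpace.IsSeparable Y) :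
    ∃ g : ℕ → StrongDual ℝ E, ∀ x ∈ Y, (∀ n, g n x = 0) → x = 0 := by
  obtain ⟨c, hc, hYc⟩ := hY
  rcases c.eq_empty_or_nonempty with rfl | hne
  · exact ⟨0, fun x hx => by simpa using hYc hx⟩
  obtain ⟨e, rfl⟩ := hc.exists_eq_range hne
  choose g hg1 hg2 using fun n => exists_dual_vector'' ℝ (e n)
  refine ⟨g, fun x hx h0 => ?_⟩
  by_contra hx0
  obtain ⟨_, ⟨n, rfl⟩, hn⟩ := Metric.mem_closure_iff.1 (hYc hx) (‖x‖ / 2)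
    (half_pos (norm_pos_iff.2 hx0))
  rw [dist_eq_norm] at hn
  have h1 : ‖e n‖ ≤ ‖x - e n‖ := by
    have h2 : g n (x - e n) = -‖e n‖ := by
      rw [map_sub, h0, hg2]
      simp
    have h3 := (g n).le_of_opNorm_le (hg1 n) (x - e n)
    rw [h2, norm_neg, norm_norm, one_mul] at h3
    exact h3
  linarith [norm_le_norm_sub_add x (e n)]

/-- The weak closure of the range is weakly compact and, by Mazur, stays in the separable closed
span. Countably many functionals separate its points, so it is metrizable and sequentially compact.
-/
theorem IsReflexive.exists_subseq_weaklyConverges (hE : IsReflexive E) {u : ℕ → E}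
    (hu : Bornology.IsBounded (range u)) :
    ∃ (u₀ : E) (k : ℕ → ℕ), StrictMono k ∧ WeaklyConverges (u ∘ k) u₀ := by
  set Y : Submodule ℝ E := (Submodule.span ℝ (range u)).topologicalClosure with hY
  have hYsep : TopologicalSpace.IsSeparable (Y : Set E) :=
    ((countable_range u).isSeparable.span (R := ℝ)).closure
  have hYclosed : IsClosed (toWeakSpace ℝ E '' (Y : Set E)) := by
    have h := Y.convex.toWeakSpace_closure (𝕜 := ℝ)
    rw [(Submodule.isClosed_topologicalClosure _).closure_eq] at h
    rw [h]
    exact isClosed_closure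
  set C : Set (WeakSpace ℝ E) := closure (toWeakSpace ℝ E '' range u)
  have hCY : C ⊆ toWeakSpace ℝ E '' (Y : Set E) := by
    refine closure_minimal (image_mono ?_) hYclosed
    exact Submodule.subset_span.trans (Submodule.le_topologicalClosure _)
  obtain ⟨g, hg⟩ := exists_seq_dual_separating hYsep
  have hcont : ∀ n, Continuous fun x : WeakSpace ℝ E => g n ((toWeakSpace ℝ E).symm x) :=
    fun n => WeakBilin.eval_continuous (topDualPairing ℝ E).flip (g n)
  have : CompactSpace C := isCompact_iff_compactSpace.1 (hE.isCompact_closure hu)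
  have : TopologicalSpace.MetrizableSpace C := by
    refine Metric.PiNatEmbed.TopologicalSpace.MetrizableSpace.of_countable_separating
      (X := C) (Y := fun _ => ℝ) (fun n (x : C) => g n ((toWeakSpace ℝ E).symm x))
      (fun n => (hcont n).comp continuous_subtype_val) ?_
    rintro ⟨x, hx⟩ ⟨y, hy⟩ hxy
    obtain ⟨x, hxY, rfl⟩ := hCY hx
    obtain ⟨y, hyY, rfl⟩ := hCY hy
    by_contra! heq
    refine hxy (Subtype.ext (congrArg (toWeakSpace ℝ E) (sub_eq_zero.1 (hg _ (Y.sub_mem hxY hyY) fun n => ?_))))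
    rw [map_sub, sub_eq_zero]
    exact heq n
  obtain ⟨a, k, hk, hlim⟩ := CompactSpace.tendsto_subseq
    (fun n => (⟨toWeakSpace ℝ E (u n), subset_closure ⟨_, ⟨n, rfl⟩, rfl⟩⟩ : C))
  refine ⟨(toWeakSpace ℝ E).symm a, k, hk, ?_⟩
  have := (continuous_subtype_val.tendsto a).comp hlim
  rw [WeaklyConverges, LinearEquiv.apply_symm_apply]
  exact this

end WeakSequentialCompactness

/-! ### The direct method and reduction of the two sets of assumptions -/

section Optimization

variable {Z X : Type*} [NormedAddCommGroup Z] [NormedSpace ℝ Z]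
  [NormedAddCommGroup X] [NormedSpace ℝ X]

theorem exists_forall_le_of_coercive (hZ : IsReflexive Z) {J : Z → ℝ}
    (hlsc : ∀ (u : ℕ → Z) (u₀ : Z), WeaklyConverges u u₀ →
      (J u₀ : EReal) ≤ liminf (fun n => (J (u n) : EReal)) atTop)
    (hcoer : Tendsto J (comap (fun u : Z => ‖u‖) atTop) atTop) :
    ∃ u, ∀ v, J u ≤ J v := by
  -- The infimum is taken in `EReal`, so `J` need not be known to be bounded below.
  obtain ⟨_, -, hlim, hmem⟩ := exists_seq_tendsto_sInf
    (range_nonempty fun u => (J u : EReal)) (OrderBot.bddBelow _)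
  choose u hu using hmem
  obtain rfl : (fun n => (J (u n) : EReal)) = _ := funext hu
  have hlt : sInf (range fun u => (J u : EReal)) < ((J 0 + 1 : ℝ) : EReal) :=
    (sInf_le (mem_range_self 0)).trans_lt (EReal.coe_lt_coe_iff.2 (lt_add_one _))
  obtain ⟨R, hR⟩ := eventually_atTop.1
    (eventually_comap.1 (hcoer.eventually_ge_atTop (J 0 + 1)))
  obtain ⟨n₀, hn₀⟩ := eventually_atTop.1 (hlim.eventually_lt_const hlt)
  -- Only the tail, where `J < J 0 + 1`, is controlled by coercivity; hence the shift by `n₀`.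
  have hb : Bornology.IsBounded (range fun n => u (n + n₀)) := by
    refine isBounded_iff_forall_norm_le.2 ⟨R, ?_⟩
    rintro _ ⟨n, rfl⟩
    by_contra! hgt
    exact (hR _ hgt.le _ rfl).not_gt (EReal.coe_lt_coe_iff.1 (hn₀ (n + n₀) (by omega)))
  obtain ⟨u₀, k, hk, hweak⟩ := hZ.exists_subseq_weaklyConverges hb
  refine ⟨u₀, fun v => EReal.coe_le_coe_iff.1 ((hlsc _ _ hweak).trans ?_)⟩
  have : Tendsto (fun n => (J (u (k n + n₀)) : EReal)) atTop
      (𝓝 (sInf (range fun u => (J u : EReal)))) :=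
    hlim.comp ((tendsto_add_atTop_nat n₀).comp hk.tendsto_atTop)
  exact this.liminf_eq.le.trans (sInf_le (mem_range_self v))

theorem AssumptionsA.exists_isSolvablePair {K : StrongDual ℝ X →ₗ[ℝ] X}
    {N : X → StrongDual ℝ X} {H : Z → X} (h : AssumptionsA K N H) :
    ∃ (hK : Continuous K) (d : ℝ), IsSolvablePair ⟨K, hK⟩ N d := by
  obtain ⟨d, hd, hKd⟩ := h.coercive
  exact ⟨h.compact.continuous, d, hd, hKd, h.continuous, h.bounded, h.monotone⟩

theorem isNegativelyMonotone_of_mu_neg_pos {N : X → StrongDual ℝ X} (h : 0 < mu (-N)) :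
    IsNegativelyMonotone N := by
  intro x y
  rcases eq_or_ne x y with rfl | hxy
  · simp
  have h1 : mu (-N) ≤ _ := (iInf_le _ x).trans ((iInf_le _ y).trans (iInf_le _ hxy))
  have h2 := EReal.coe_pos.1 (h.trans_le h1)
  have h3 : 0 < ‖x - y‖ ^ 2 := by
    have := norm_pos_iff.2 (sub_ne_zero.2 hxy)
    positivity
  have h4 := (div_pos_iff_of_pos_right h3).1 h2
  simp only [Pi.neg_apply, _root_.sub_apply, _root_.neg_apply] at h4 ⊢
  linarith

theorem _root_.LipschitzWith.isBoundedOperator {E F : Type*} [NormedAddCommGroup E]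
    [NormedAddCommGroup F] {C : ℝ≥0} {N : E → F} (hN : LipschitzWith C N) :
    IsBoundedOperator N :=
  fun _ hs => hN.isBounded_image hs

theorem AssumptionsB.exists_isSolvablePair [CompleteSpace X] {K : StrongDual ℝ X →ₗ[ℝ] X}
    {N : X → StrongDual ℝ X} {H : Z → X} (h : AssumptionsB K N H) :
    ∃ (hK : Continuous K) (d : ℝ), IsSolvablePair ⟨K, hK⟩ N d := by
  obtain ⟨c, hc, hKc⟩ := h.classM
  obtain ⟨C, hC⟩ := h.lipschitz
  have hKc' : ∀ f : StrongDual ℝ X, c * ‖f‖ ^ 2 ≤ f (K f) := fun f => by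
    simpa [viaDoubleDual] using hKc f 0
  have hK : Continuous K := continuous_of_monotone K fun f =>
    (mul_nonneg hc.le (sq_nonneg _)).trans (hKc' f)
  obtain ⟨M, hM, hKM⟩ := (⟨K, hK⟩ : StrongDual ℝ X →L[ℝ] X).bound
  -- From `‖Kf‖ ≤ M‖f‖`, the bound `c‖f‖² ≤ f(Kf)` gives coercivity in `‖Kf‖` with constant `c /
  -- M²`.
  refine ⟨hK, c / M ^ 2, by positivity, fun f => ?_, hC.continuous, hC.isBoundedOperator,
    isNegativelyMonotone_of_mu_neg_pos h.mu_pos⟩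
  refine le_trans ?_ (hKc' f)
  have h1 : ‖K f‖ ^ 2 ≤ (M * ‖f‖) ^ 2 := pow_le_pow_left₀ (norm_nonneg _) (hKM f) 2
  calc c / M ^ 2 * ‖K f‖ ^ 2 ≤ c / M ^ 2 * (M * ‖f‖) ^ 2 := by gcongr
    _ = c * ‖f‖ ^ 2 := by field_simp

end Optimization

end Hammerstein

theorem mainTheorem3 {Z X : Type*}
    [NormedAddCommGroup Z] [NormedSpace ℝ Z] [CompleteSpace Z]
    [NormedAddCommGroup X] [NormedSpace ℝ X] [CompleteSpace X]
    (hZ : Hammerstein.IsReflexive Z) (hX : Hammerstein.IsReflexive X)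
    (K : StrongDual ℝ X →ₗ[ℝ] X) (N : X → StrongDual ℝ X) (H : Z → X)
    (hKNH : Hammerstein.AssumptionsA K N H ∨ Hammerstein.AssumptionsB K N H) :
    (∀ u : Z, ∃! x : X, Hammerstein.Solves K N H u x) ∧
    ∀ T : Z → X, (∀ u : Z, Hammerstein.Solves K N H u (T u)) →
      ∀ φ : Z × Set.range T → ℝ,
        Hammerstein.WeakStrongLSC φ →
        Filter.Tendsto (fun u : Z => φ (u, ⟨T u, Set.mem_range_self u⟩))
          (Filter.comap (fun u : Z => ‖u‖) Filter.atTop) Filter.atTop →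
        ∃ (u : Z) (x : Set.range T), Hammerstein.IsOptimalPair K N H φ u x := by
  have hH : Hammerstein.IsCompletelyContinuous H :=
    hKNH.elim (·.completelyContinuous) (·.completelyContinuous)
  obtain ⟨hK, d, hKN⟩ : ∃ (hK : Continuous K) (d : ℝ), Hammerstein.IsSolvablePair ⟨K, hK⟩ N d :=
    hKNH.elim (·.exists_isSolvablePair) (·.exists_isSolvablePair)
  refine ⟨fun u => ?_, fun T hT φ hlsc hcoer => ?_⟩
  · obtain ⟨x, hx⟩ := hKN.exists_solution hX (H u)
    exact ⟨x, hx, fun y hy => hKN.solution_unique hy hx⟩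
  · obtain ⟨u, hu⟩ := Hammerstein.exists_forall_le_of_coercive hZ
      (J := fun u => φ (u, ⟨T u, Set.mem_range_self u⟩))
      (fun v v₀ hv => hlsc v v₀ _ _ hv <| tendsto_subtype_rng.2 <|
        hKN.tendsto_solution (fun n => hT (v n)) (hT v₀) (hH v v₀ hv)) hcoer
    refine ⟨u, ⟨T u, Set.mem_range_self u⟩, hT u, fun u' x' hx' => ?_⟩
    -- By uniqueness every admissible pair has the form `(u', T u')`, so minimizing over controls
    -- suffices.
    obtain rfl : x' = ⟨T u', Set.mem_range_self u'⟩ :=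
      Subtype.ext (hKN.solution_unique hx' (hT u'))
    exact hu u'
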